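/- Setting. There are $M$ arms, partitioned into $K$ nonempty clusters; $\mathcal C_i$ is the cluster of arm $i$. The arms of a cluster $\mathcal C$ share an unknown parameter $\theta_{\mathcal C}\in\Theta\subset\mathbb R^d$; the rewards of arm $i$ are independent with a known law $P_{i,\theta_{\mathcal C_i}}$ on $\mathbb R$ of finite mean $\mu_i(\theta_{\mathcal C_i})$. For $\theta=(\theta_{\mathcal C})_{\mathcal C}\in\Theta^K$ let $\mu^\star(\theta)=\max_i\mu_i(\theta_{\mathcal C_i})$ and $\Delta_i=\mu^\star(\theta)-\mu_i(\theta_{\mathcal C_i})$. A policy $\pi$ is a family of measurable maps that choose the arm pulled at each time from the past arms and rewards; $N_i(T)$ is the number of plays of arm $i$ up to time $T$, $N_{\mathcal C}(T)=\sum_{i\in\mathcal C}N_i(T)$, and $R(\pi,T)=\sum_i N_i(T)\Delta_i$. The policy is uniformly good if $\limsup_{T\to\infty}\mathbb E_{\pi,\theta}R(\pi,T)/T^a=0$ for all $\theta\in\Theta^K$ and all $a>0$. With $KL_j(\vartheta\|\vartheta')=KL(P_{j,\vartheta}\|P_{j,\vartheta'})$ put, for $\vartheta\in\Theta$ and $m\in\mathbb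 R$, $$\phi_i(\vartheta,m)=\inf\Big\{\max_{j\in\mathcal C_i}KL_j(\vartheta\|\vartheta'):\vartheta'\in\Theta,\ \mu_i(\vartheta')\ge m\Big\},\qquad \phi_i(\vartheta,m+)=\inf\Big\{\max_{j\in\mathcal C_i}KL_j(\vartheta\|\vartheta'):\vartheta'\in\Theta,\ \mu_i(\vartheta')> m\Big\},$$ where $\inf\emptyset=\infty$, $1/0=\infty$, $1/\infty=0$ and $0\cdot\infty=0$. (So $\phi_i(\vartheta,m+)=\lim_{m'\downarrow m}\phi_i(\vartheta,m')$.) Theorem. Let $\pi$ be a uniformly good policy, $\theta^\star\in\Theta^K$ and $\mu^\star=\mu^\star(\theta^\star)$. (1) If the cluster $\mathcal C$ contains no optimal arm, then $$\liminf_{T\to\infty}\frac{\mathbb E_{\pi,\theta^\star}N_{\mathcal C}(T)}{\log T}\ \ge\ \max_{i\in\mathcal C}\frac1{\phi_i(\theta^\star_{\mathcal C},\mu^\star+)},$$ and if $\phi_i(\theta^\star_{\mathcal C},\cdot)$ is right-continuous at $\mu^\star$ for every $i\in\mathcal C$, then $$\liminf_{T\to\infty}\frac{\mathbb E_{\pi,\theta^\star}N_{\mathcal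 C}(T)}{\log T}\ \ge\ \max_{i\in\mathcal C}\frac1{\phi_i(\theta^\star_{\mathcal C},\mu^\star)}.$$ (2) Let $\mathcal C^\star$ be the cluster of an optimal arm. Then $$\liminf_{T\to\infty}\frac{\mathbb E_{\pi,\theta^\star}R(\pi,T)}{\log T}\ \ge\ \sum_{\mathcal C\ne\mathcal C^\star}\Big(\min_{i\in\mathcal C}\Delta_i\Big)\Big(\max_{i\in\mathcal C}\frac1{\phi_i(\theta^\star_{\mathcal C},\mu^\star+)}\Big),$$ and the same holds with $\phi_i(\theta^\star_{\mathcal C},\mu^\star)$ in place of $\phi_i(\theta^\star_{\mathcal C},\mu^\star+)$ if the right-continuity in (1) holds for every cluster that contains no optimal arm. (3) In both versions the sum in (2) is of order $K-1$: it lies between $(K-1)\,b$ and $(K-1)\,b'$, where $b$ and $b'$ are its smallest and its largest term; $b>0$ if every cluster $\mathcal C\neq\mathcal C^\star$ contains no optimal arm and has an arm $i$ whose $\phi_i$ in the sum is finite, and $b'<\infty$ if all the $\phi_i$ in the sum are positive. -/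

import Mathlib

open MeasureTheory ProbabilityTheory Filter Topology
open scoped ENNReal

noncomputable section

/-- A bandit model with `M` arms partitioned into `K` (nonempty) clusters.  All arms of a cluster
share one parameter, which ranges over the set `Θ ⊆ ℝ^d` of allowable parameters; `reward i θ` is
the known law of one reward of arm `i` when the parameter of its cluster is `θ`. -/
structure ClusteredBandit (M K d : ℕ) where
  /-- the cluster an arm belongs to -/
  cluster : Fin M → Fin K
  cluster_surjective : Function.Surjective cluster
  /-- the set of allowable parameters -/
  Θ : Set (EuclideanSpace ℝ (Fin d))
  /-- the reward distributions -/
  reward : Fin M → Θ → Measure ℝ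
  isProbabilityMeasure_reward : ∀ i θ, IsProbabilityMeasure (reward i θ)
  integrable_reward : ∀ i θ, Integrable (fun x : ℝ => x) (reward i θ)

/-- A learning policy: the arm pulled at time `t + 1` is a measurable function of the `t` pairs
(arm pulled, reward received) observed at the times `1, …, t`. -/
structure LearningPolicy (M : ℕ) where
  choose : (t : ℕ) → (Fin t → Fin M × ℝ) → Fin M
  measurable_choose : ∀ t, Measurable (choose t)

/-- `N_i(T)`: the number of plays of arm `i` in a history of length `T`. -/
def numPlays {M T : ℕ} (h : Fin T → Fin M × ℝ) (i : Fin M) : ℕ :=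
  (Finset.univ.filter fun s : Fin T => (h s).1 = i).card

namespace ClusteredBandit

variable {M K d : ℕ} (B : ClusteredBandit M K d)

/-- Mean reward of arm `i` when the parameter of its cluster is `θ`. -/
def armMean (i : Fin M) (θ : B.Θ) : ℝ := ∫ x, x ∂(B.reward i θ)

/-- `μ_i(θ)`: mean reward of arm `i` under the parameter vector `θ ∈ Θ^K`. -/
def mean (θ : Fin K → B.Θ) (i : Fin M) : ℝ := B.armMean i (θ (B.cluster i))

/-- `μ⋆(θ) = max_i μ_i(θ)`. -/
def optMean (θ : Fin K → B.Θ) : ℝ := ⨆ i : Fin M, B.mean θ i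

/-- The sub-optimality gap `Δ_i = μ⋆ - μ_i`. -/
def gap (θ : Fin K → B.Θ) (i : Fin M) : ℝ := B.optMean θ - B.mean θ i

/-- The cluster `c` contains no optimal arm. -/
def NoOptimalArm (θ : Fin K → B.Θ) (c : Fin K) : Prop :=
  ∀ i, B.cluster i = c → B.mean θ i < B.optMean θ

/-- `KL_i(θ ‖ θ')`. -/
def armKL (i : Fin M) (θ θ' : B.Θ) : ℝ≥0∞ :=
  InformationTheory.klDiv (B.reward i θ) (B.reward i θ')

/-- `φ_i(θ, m) = inf { max_{j ∈ C_i} KL_j(θ ‖ θ') : θ' ∈ Θ, μ_i(θ') ≥ m }`, with `inf ∅ = ∞`. -/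
def phi (i : Fin M) (θ : B.Θ) (m : ℝ) : ℝ≥0∞ :=
  ⨅ (θ' : B.Θ) (_ : m ≤ B.armMean i θ'),
    ⨆ (j : Fin M) (_ : B.cluster j = B.cluster i), B.armKL j θ θ'

/-- `φ_i(θ, m+) = inf { max_{j ∈ C_i} KL_j(θ ‖ θ') : θ' ∈ Θ, μ_i(θ') > m }`, with `inf ∅ = ∞`. -/
def phiStrict (i : Fin M) (θ : B.Θ) (m : ℝ) : ℝ≥0∞ :=
  ⨅ (θ' : B.Θ) (_ : m < B.armMean i θ'),
    ⨆ (j : Fin M) (_ : B.cluster j = B.cluster i), B.armKL j θ θ'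

/-- The law of a reward as a function of the arm pulled, under the parameter vector `θ`. -/
def rewardKernel (θ : Fin K → B.Θ) : Kernel (Fin M) ℝ :=
  Kernel.ofFunOfCountable fun i => B.reward i (θ (B.cluster i))

/-- `P_{π,θ}` on the sample paths of length `T`: given the first `T` pairs `h`, the policy pulls
the arm `π.choose T h` and receives a fresh reward with the law of that arm. -/
def histLaw (θ : Fin K → B.Θ) (π : LearningPolicy M) : (T : ℕ) → Measure (Fin T → Fin M × ℝ)
  | 0 => Measure.dirac (fun s => s.elim0)
  | T + 1 =>
    (histLaw θ π T ⊗ₘ (B.rewardKernel θ).comap (π.choose T) (π.measurable_choose T)).map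
      fun p => Fin.snoc (α := fun _ => Fin M × ℝ) p.1 (π.choose T p.1, p.2)

/-- `E_{π,θ} N_C(T)`, where `N_C(T) = ∑_{i ∈ C} N_i(T)`. -/
def expPlays (θ : Fin K → B.Θ) (π : LearningPolicy M) (c : Fin K) (T : ℕ) : ℝ :=
  ∫ h, ∑ i ∈ Finset.univ.filter (fun i => B.cluster i = c), (numPlays h i : ℝ) ∂(B.histLaw θ π T)

/-- `E_{π,θ} R(π,T)`, where `R(π,T) = ∑_i N_i(T) (μ⋆ - μ_i)`. -/
def expRegret (θ : Fin K → B.Θ) (π : LearningPolicy M) (T : ℕ) : ℝ :=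
  ∫ h, ∑ i, (numPlays h i : ℝ) * B.gap θ i ∂(B.histLaw θ π T)

/-- Uniformly good policies: for every parameter vector the expected regret is `o(T^a)` for
every `a > 0`. -/
def UniformlyGood (π : LearningPolicy M) : Prop :=
  ∀ θ : Fin K → B.Θ, ∀ a : ℝ, 0 < a →
    limsup (fun T : ℕ => ((B.expRegret θ π T / (T : ℝ) ^ a : ℝ) : EReal)) atTop = 0

/-- `max_{i ∈ C} 1 / φ_i(θ_C, μ⋆)` for a given family `φ` (with `1 / 0 = ∞` and `1 / ∞ = 0`). -/
def maxInv (φ : Fin M → B.Θ → ℝ → ℝ≥0∞) (θ : Fin K → B.Θ) (c : Fin K) : ℝ≥0∞ :=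
  ⨆ (i : Fin M) (_ : B.cluster i = c), (φ i (θ c) (B.optMean θ))⁻¹

/-- `(min_{i ∈ C} Δ_i) * max_{i ∈ C} 1 / φ_i(θ_C, μ⋆)` (with `0 * ∞ = 0`). -/
def regretTerm (φ : Fin M → B.Θ → ℝ → ℝ≥0∞) (θ : Fin K → B.Θ) (c : Fin K) : ℝ≥0∞ :=
  (⨅ (i : Fin M) (_ : B.cluster i = c), ENNReal.ofReal (B.gap θ i)) * B.maxInv φ θ c

/-- `φ_i(θ_C, ·)` is right-continuous at `μ⋆` for every arm `i` of the cluster `c`. -/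
def PhiRightCont (θ : Fin K → B.Θ) (c : Fin K) : Prop :=
  ∀ i, B.cluster i = c →
    ContinuousWithinAt (fun m => B.phi i (θ c) m) (Set.Ici (B.optMean θ)) (B.optMean θ)

end ClusteredBandit

end

/-! The argument is a change of measure in the manner of Lai and Robbins. Move the parameter of one
cluster `c` without optimal arm to some `ϑ` that lifts an arm of `c` strictly above the old optimum.
Histories under the two models differ only through rewards from `c`, so their divergence is at most
`D` times the expected plays of `c`, where `D` bounds every `KL_j` on `c`
(`klDiv_histLaw_update_le`).

A uniformly good policy must nevertheless separate the models: `c` is rarely played under the old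
one and takes almost all rounds under the new one. The event that `c` gets fewer than `T / 2` plays
has probability near 1 under the old model and at most `T ^ (a - 1)` under the new one. The
variational bound `mul_measureReal_add_le_toReal_klDiv` turns this into a divergence of nearly `log
T`, so `c` is played at least about `log T / D` times (`eventually_le_expPlays_div_log`). Optimising
over `ϑ` and the lifted arm gives `maxInv B.phiStrict`.

For the regret, each play of a cluster costs at least its smallest gap, and the liminf is
superadditive. The order `K - 1` is a count of the summands. -/

/-! ### Kullback-Leibler divergence: chain rule and variational bound. -/

section KullbackLeibler

open InformationTheory

/-- The conditional Kullback-Leibler divergence as an average of divergences. -/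
lemma klDiv_compProd_right_eq_lintegral {α β : Type*} {mα : MeasurableSpace α}
    {mβ : MeasurableSpace β} [MeasurableSpace.CountableOrCountablyGenerated α β]
    (μ : Measure α) [IsFiniteMeasure μ] (κ η : Kernel α β) [IsFiniteKernel κ] [IsFiniteKernel η]
    (hac : ∀ a, κ a ≪ η a) :
    klDiv (μ ⊗ₘ κ) (μ ⊗ₘ η) = ∫⁻ a, klDiv (κ a) (η a) ∂μ := by
  have hm : Measurable (Function.uncurry (κ.rnDeriv η)) := κ.measurable_rnDeriv η
  have hκ : η.withDensity (κ.rnDeriv η) = κ := by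
    ext1 a
    exact Kernel.withDensity_rnDeriv_eq (hac a)
  -- With a common first marginal, the joint density is the density of the kernels, so the integral
  -- of `klFun` disintegrates.
  have hd : μ ⊗ₘ κ = (μ ⊗ₘ η).withDensity (Function.uncurry (κ.rnDeriv η)) := by
    have : IsSFiniteKernel (η.withDensity (κ.rnDeriv η)) := by rw [hκ]; infer_instance
    have := Measure.compProd_withDensity (μ := μ) (κ := η) hm
    rw [hκ] at this
    exact this
  have hae : (μ ⊗ₘ κ).rnDeriv (μ ⊗ₘ η) =ᵐ[μ ⊗ₘ η] Function.uncurry (κ.rnDeriv η) := by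
    rw [hd]
    exact Measure.rnDeriv_withDensity _ hm
  rw [klDiv_eq_lintegral_klFun_of_ac (Measure.AbsolutelyContinuous.compProd_right
    (Filter.Eventually.of_forall hac))]
  rw [lintegral_congr_ae (g := fun p => ENNReal.ofReal (klFun (κ.rnDeriv η p.1 p.2).toReal))
    (by filter_upwards [hae] with p hp; rw [hp]; rfl)]
  rw [Measure.lintegral_compProd (by fun_prop)]
  refine lintegral_congr fun a => ?_
  rw [klDiv_eq_lintegral_klFun_of_ac (hac a)]
  refine lintegral_congr_ae ?_
  filter_upwards [Kernel.rnDeriv_eq_rnDeriv_measure (κ := κ) (η := η) (a := a)] with b hb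
  rw [hb]

/-- Fenchel-Young inequality: the convex conjugate of `klFun` is `exp t - 1`. For `x > 0` it is `u +
1 ≤ exp u` at `u = t - log x`. -/
lemma mul_add_one_sub_exp_le_klFun {x : ℝ} (hx : 0 ≤ x) (t : ℝ) :
    t * x + (1 - Real.exp t) ≤ klFun x := by
  rcases hx.eq_or_lt with rfl | hx
  · simp [klFun_zero, Real.exp_nonneg]
  · have h := Real.add_one_le_exp (t - Real.log x)
    rw [Real.exp_sub, Real.exp_log hx, le_div_iff₀ hx] at h
    rw [klFun_apply]
    nlinarith

/-- A variational lower bound on the Kullback-Leibler divergence, for the indicator of `s`. -/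
lemma mul_measureReal_add_le_toReal_klDiv {α : Type*} {mα : MeasurableSpace α}
    {μ ν : Measure α} [IsFiniteMeasure μ] [IsFiniteMeasure ν] (h : klDiv μ ν ≠ ∞)
    (s : Set α) (t : ℝ) :
    t * μ.real s + (1 - Real.exp t) * ν.real s ≤ (klDiv μ ν).toReal := by
  obtain ⟨hac, hint⟩ := klDiv_ne_top_iff.1 h
  rw [toReal_klDiv_eq_integral_klFun hac]
  have hi : Integrable (fun x => klFun (μ.rnDeriv ν x).toReal) ν :=
    (integrable_klFun_rnDeriv_iff hac).2 hint
  have hr : Integrable (fun x => t * (μ.rnDeriv ν x).toReal) (ν.restrict s) :=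
    (Measure.integrable_toReal_rnDeriv.const_mul t).restrict
  -- The test function is `t` on `s` and `0` off `s`; for the value `0` the pointwise inequality is
  -- just `0 ≤ klFun`.
  calc t * μ.real s + (1 - Real.exp t) * ν.real s
      = ∫ x in s, (t * (μ.rnDeriv ν x).toReal + (1 - Real.exp t)) ∂ν := by
        rw [integral_add hr (integrable_const _), integral_const_mul,
          Measure.setIntegral_toReal_rnDeriv hac]
        simp [mul_comm]
    _ ≤ ∫ x in s, klFun (μ.rnDeriv ν x).toReal ∂ν :=
        integral_mono (hr.add (integrable_const _)) hi.restrict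
          fun x => mul_add_one_sub_exp_le_klFun ENNReal.toReal_nonneg t
    _ ≤ ∫ x, klFun (μ.rnDeriv ν x).toReal ∂ν :=
        setIntegral_le_integral hi (Eventually.of_forall fun x => klFun_nonneg ENNReal.toReal_nonneg)

end KullbackLeibler

/-- Supplies a uniform positive gap. The empty case occurs when `c` is the only cluster and the arms
outside `c` are considered. -/
lemma Finset.exists_pos_forall_le {ι : Type*} (s : Finset ι) (f : ι → ℝ) (hf : ∀ i ∈ s, 0 < f i) :
    ∃ δ > 0, ∀ i ∈ s, δ ≤ f i := by
  rcases s.eq_empty_or_nonempty with rfl | hs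
  · exact ⟨1, one_pos, by simp⟩
  · obtain ⟨i, hi, hmin⟩ := s.exists_min_image f hs
    exact ⟨f i, hf i hi, hmin⟩

/-! ### Counting plays along a history. -/

namespace ClusteredBandit

open InformationTheory

variable {M K d : ℕ} (B : ClusteredBandit M K d)

/-- The number of plays of the arms of the cluster `c` in a history. -/
def clusterPlays {T : ℕ} (h : Fin T → Fin M × ℝ) (c : Fin K) : ℕ :=
  (Finset.univ.filter fun s : Fin T => B.cluster (h s).1 = c).card

lemma sum_numPlays_eq_clusterPlays {T : ℕ} (h : Fin T → Fin M × ℝ) (c : Fin K) :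
    ∑ i ∈ Finset.univ.filter (fun i => B.cluster i = c), numPlays h i = B.clusterPlays h c := by
  unfold clusterPlays numPlays
  rw [Finset.card_eq_sum_card_fiberwise (f := fun s => (h s).1)
    (t := Finset.univ.filter (fun i => B.cluster i = c)) (by intro s; simp)]
  refine Finset.sum_congr rfl fun i hi => ?_
  congr 1
  ext s
  simp only [Finset.mem_filter, Finset.mem_univ, true_and] at hi ⊢
  constructor
  · rintro rfl; exact ⟨hi, rfl⟩
  · exact fun h => h.2

lemma sum_numPlays {T : ℕ} (h : Fin T → Fin M × ℝ) : ∑ i, numPlays h i = T := by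
  unfold numPlays
  rw [← Finset.card_eq_sum_card_fiberwise (f := fun s => (h s).1) (t := Finset.univ)
    (by intro s; simp)]
  simp

lemma measurable_numPlays {T : ℕ} (i : Fin M) :
    Measurable fun h : Fin T → Fin M × ℝ => numPlays h i := by
  unfold numPlays
  simp_rw [Finset.card_filter]
  refine Finset.measurable_fun_sum _ fun s _ => ?_
  exact Measurable.ite ((measurable_pi_apply s).fst (measurableSet_singleton i))
    measurable_const measurable_const

lemma measurable_clusterPlays {T : ℕ} (c : Fin K) :
    Measurable fun h : Fin T → Fin M × ℝ => B.clusterPlays h c := by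
  simp_rw [← sum_numPlays_eq_clusterPlays]
  exact Finset.measurable_fun_sum _ fun i _ => measurable_numPlays i

lemma clusterPlays_le {T : ℕ} (h : Fin T → Fin M × ℝ) (c : Fin K) : B.clusterPlays h c ≤ T := by
  unfold clusterPlays
  exact (Finset.card_le_univ _).trans (by simp)

lemma clusterPlays_snoc {T : ℕ} (h : Fin T → Fin M × ℝ) (p : Fin M × ℝ) (c : Fin K) :
    B.clusterPlays (Fin.snoc (α := fun _ => Fin M × ℝ) h p : Fin (T + 1) → Fin M × ℝ) c
      = B.clusterPlays h c + if B.cluster p.1 = c then 1 else 0 := by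
  unfold clusterPlays
  simp_rw [Finset.card_filter, Fin.sum_univ_castSucc, Fin.snoc_castSucc, Fin.snoc_last]

/-! ### The law of the history and the information it carries. -/

lemma measurable_snoc_choose (π : LearningPolicy M) (T : ℕ) :
    Measurable fun p : (Fin T → Fin M × ℝ) × ℝ =>
      (Fin.snoc (α := fun _ => Fin M × ℝ) p.1 (π.choose T p.1, p.2) :
        Fin (T + 1) → Fin M × ℝ) := by
  refine measurable_pi_lambda _ fun s => ?_
  refine Fin.lastCases ?_ (fun s => ?_) s
  · simp only [Fin.snoc_last]
    exact ((π.measurable_choose T).comp measurable_fst).prodMk measurable_snd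
  · simp only [Fin.snoc_castSucc]
    exact (measurable_pi_apply s).comp measurable_fst

instance (θ : Fin K → B.Θ) : IsMarkovKernel (B.rewardKernel θ) :=
  ⟨fun i => B.isProbabilityMeasure_reward i _⟩

instance isProbabilityMeasure_histLaw (θ : Fin K → B.Θ) (π : LearningPolicy M) :
    ∀ T, IsProbabilityMeasure (B.histLaw θ π T)
  | 0 => by unfold histLaw; infer_instance
  | T + 1 => by
    have := isProbabilityMeasure_histLaw θ π T
    unfold histLaw
    exact Measure.isProbabilityMeasure_map (measurable_snoc_choose π T).aemeasurable

lemma lintegral_clusterPlays_succ (θ : Fin K → B.Θ) (π : LearningPolicy M) (c : Fin K) (T : ℕ) :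
    ∫⁻ h, (B.clusterPlays h c : ℝ≥0∞) ∂(B.histLaw θ π (T + 1))
      = ∫⁻ h, (B.clusterPlays h c : ℝ≥0∞) ∂(B.histLaw θ π T)
        + ∫⁻ h, (if B.cluster (π.choose T h) = c then 1 else 0) ∂(B.histLaw θ π T) := by
  have hm : ∀ T, Measurable fun h : Fin T → Fin M × ℝ => (B.clusterPlays h c : ℝ≥0∞) := fun T =>
    measurable_from_top.comp (B.measurable_clusterPlays c)
  rw [histLaw, lintegral_map (hm _) (measurable_snoc_choose π T), ← lintegral_add_left (hm T)]
  refine (Measure.lintegral_compProd ((hm _).comp (measurable_snoc_choose π T))).trans ?_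
  refine lintegral_congr fun h => ?_
  simp [clusterPlays_snoc]

/-- The information processed up to time `T` when only the parameter of the cluster `c` differs. -/
lemma klDiv_histLaw_update_le (θ : Fin K → B.Θ) (π : LearningPolicy M) (c : Fin K) (ϑ : B.Θ)
    {D : ℝ≥0∞} (hD : D ≠ ∞) (hle : ∀ j, B.cluster j = c → B.armKL j (θ c) ϑ ≤ D) (T : ℕ) :
    klDiv (B.histLaw θ π T) (B.histLaw (Function.update θ c ϑ) π T)
      ≤ D * ∫⁻ h, (B.clusterPlays h c : ℝ≥0∞) ∂(B.histLaw θ π T) := by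
  set θ' := Function.update θ c ϑ with hθ'
  have hkl : ∀ i, klDiv (B.rewardKernel θ i) (B.rewardKernel θ' i)
      ≤ D * if B.cluster i = c then 1 else 0 := by
    intro i
    change klDiv (B.reward i (θ (B.cluster i))) (B.reward i (θ' (B.cluster i))) ≤ _
    have := B.isProbabilityMeasure_reward i (θ (B.cluster i))
    by_cases h : B.cluster i = c
    · have h2 := hle i h
      simpa [h, hθ', armKL] using h2
    · simp [h, hθ']
  -- Finiteness of `D` forces absolute continuity on `c`; off `c` the laws coincide.
  have hac : ∀ i, B.rewardKernel θ i ≪ B.rewardKernel θ' i := by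
    intro i
    refine (klDiv_ne_top_iff.1 (ne_top_of_le_ne_top ?_ (hkl i))).1
    split_ifs <;> simp [hD]
  induction T with
  | zero =>
    unfold histLaw
    simp
  | succ T ih =>
    have e : klDiv (B.histLaw θ π (T + 1)) (B.histLaw θ' π (T + 1)) ≤
        klDiv (B.histLaw θ π T) (B.histLaw θ' π T) +
        ∫⁻ h, klDiv (B.rewardKernel θ (π.choose T h)) (B.rewardKernel θ' (π.choose T h))
          ∂(B.histLaw θ π T) := by
      rw [histLaw, histLaw]
      -- Data processing for the map that appends a round; only this inequality is needed. The chain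
      -- rule then splits off the new reward.
      refine (klDiv_map_le _ _ (measurable_snoc_choose π T)).trans (le_of_eq ?_)
      rw [klDiv_compProd_eq_add, klDiv_compProd_right_eq_lintegral]
      · rfl
      · exact fun h => hac _
    refine e.trans ?_
    rw [lintegral_clusterPlays_succ, mul_add]
    refine add_le_add ih ?_
    rw [← lintegral_const_mul' _ _ hD]
    exact lintegral_mono fun h => hkl _

/-! ### Expected plays and expected regret. -/

lemma integrable_numPlays (θ : Fin K → B.Θ) (π : LearningPolicy M) (T : ℕ) (i : Fin M) :
    Integrable (fun h : Fin T → Fin M × ℝ => (numPlays h i : ℝ)) (B.histLaw θ π T) := by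
  refine Integrable.of_bound
    (measurable_from_top.comp (measurable_numPlays i)).aestronglyMeasurable (T : ℝ) ?_
  refine Eventually.of_forall fun h => ?_
  have : numPlays h i ≤ T := (Finset.card_le_univ _).trans (by simp)
  simpa using this

lemma integrable_clusterPlays (θ : Fin K → B.Θ) (π : LearningPolicy M) (T : ℕ) (c : Fin K) :
    Integrable (fun h : Fin T → Fin M × ℝ => (B.clusterPlays h c : ℝ)) (B.histLaw θ π T) := by
  refine Integrable.of_bound
    (measurable_from_top.comp (B.measurable_clusterPlays c)).aestronglyMeasurable (T : ℝ) ?_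
  refine Eventually.of_forall fun h => ?_
  simpa using B.clusterPlays_le h c

lemma expPlays_eq_integral_clusterPlays (θ : Fin K → B.Θ) (π : LearningPolicy M) (c : Fin K)
    (T : ℕ) : B.expPlays θ π c T = ∫ h, (B.clusterPlays h c : ℝ) ∂(B.histLaw θ π T) := by
  unfold expPlays
  simp_rw [← sum_numPlays_eq_clusterPlays]
  push_cast
  rfl

lemma expPlays_nonneg (θ : Fin K → B.Θ) (π : LearningPolicy M) (c : Fin K) (T : ℕ) :
    0 ≤ B.expPlays θ π c T := by
  rw [expPlays_eq_integral_clusterPlays]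
  exact integral_nonneg fun h => Nat.cast_nonneg _

lemma lintegral_clusterPlays (θ : Fin K → B.Θ) (π : LearningPolicy M) (c : Fin K) (T : ℕ) :
    ∫⁻ h, (B.clusterPlays h c : ℝ≥0∞) ∂(B.histLaw θ π T)
      = ENNReal.ofReal (B.expPlays θ π c T) := by
  rw [expPlays_eq_integral_clusterPlays, ofReal_integral_eq_lintegral_ofReal
    (B.integrable_clusterPlays θ π T c) (Eventually.of_forall fun h => Nat.cast_nonneg _)]
  simp

lemma mean_le_optMean (θ : Fin K → B.Θ) (i : Fin M) : B.mean θ i ≤ B.optMean θ :=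
  le_ciSup (Set.finite_range _).bddAbove i

lemma gap_nonneg (θ : Fin K → B.Θ) (i : Fin M) : 0 ≤ B.gap θ i :=
  sub_nonneg.2 (B.mean_le_optMean θ i)

lemma expRegret_eq_sum (θ : Fin K → B.Θ) (π : LearningPolicy M) (T : ℕ) :
    B.expRegret θ π T = ∑ i, (∫ h, (numPlays h i : ℝ) ∂(B.histLaw θ π T)) * B.gap θ i := by
  unfold expRegret
  rw [integral_finsetSum _ fun i _ => (B.integrable_numPlays θ π T i).mul_const _]
  simp_rw [integral_mul_const]

lemma expPlays_eq_sum (θ : Fin K → B.Θ) (π : LearningPolicy M) (c : Fin K) (T : ℕ) :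
    B.expPlays θ π c T = ∑ i ∈ Finset.univ.filter (fun i => B.cluster i = c),
      ∫ h, (numPlays h i : ℝ) ∂(B.histLaw θ π T) := by
  unfold expPlays
  rw [integral_finsetSum _ fun i _ => B.integrable_numPlays θ π T i]

/-- Group the regret by clusters and drop those outside `s`, whose contribution is nonnegative. It
serves for one cluster, for all clusters but one, and for the final regret bound. -/
lemma sum_mul_expPlays_le_expRegret (θ : Fin K → B.Θ) (π : LearningPolicy M) (s : Finset (Fin K))
    (δ : Fin K → ℝ) (hδ : ∀ i, B.cluster i ∈ s → δ (B.cluster i) ≤ B.gap θ i) (T : ℕ) :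
    ∑ c ∈ s, δ c * B.expPlays θ π c T ≤ B.expRegret θ π T := by
  have h0 : ∀ i, 0 ≤ ∫ h, (numPlays h i : ℝ) ∂(B.histLaw θ π T) := fun i =>
    integral_nonneg fun h => Nat.cast_nonneg _
  rw [expRegret_eq_sum, ← Finset.sum_fiberwise (s := Finset.univ) B.cluster]
  calc ∑ c ∈ s, δ c * B.expPlays θ π c T
      ≤ ∑ c ∈ s, ∑ i with B.cluster i = c,
          (∫ h, (numPlays h i : ℝ) ∂(B.histLaw θ π T)) * B.gap θ i := by
        refine Finset.sum_le_sum fun c hc => ?_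
        rw [expPlays_eq_sum, Finset.mul_sum]
        refine Finset.sum_le_sum fun i hi => ?_
        obtain rfl := (Finset.mem_filter.1 hi).2
        rw [mul_comm]
        exact mul_le_mul_of_nonneg_left (hδ i hc) (h0 i)
    _ ≤ _ := Finset.sum_le_sum_of_subset_of_nonneg (Finset.subset_univ _) fun c _ _ =>
        Finset.sum_nonneg fun i _ => mul_nonneg (h0 i) (B.gap_nonneg θ i)

lemma sum_expPlays (θ : Fin K → B.Θ) (π : LearningPolicy M) (T : ℕ) :
    ∑ c, B.expPlays θ π c T = T := by
  simp_rw [expPlays_eq_sum]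
  rw [Finset.sum_fiberwise, ← integral_finsetSum _ fun i _ => B.integrable_numPlays θ π T i]
  simp_rw [← Nat.cast_sum, sum_numPlays]
  simp

/-! ### Uniform goodness and the logarithmic lower bound. -/

lemma UniformlyGood.eventually_expRegret_le {B : ClusteredBandit M K d} {π : LearningPolicy M}
    (hπ : B.UniformlyGood π) (θ : Fin K → B.Θ) {a ε : ℝ} (ha : 0 < a) (hε : 0 < ε) :
    ∀ᶠ T : ℕ in atTop, B.expRegret θ π T ≤ ε * (T : ℝ) ^ a := by
  have h := eventually_lt_of_limsup_lt (b := ((ε : ℝ) : EReal))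
    (by rw [hπ θ a ha]; exact_mod_cast hε)
  filter_upwards [h, eventually_gt_atTop 0] with T hT hT0
  have hT : B.expRegret θ π T / (T : ℝ) ^ a < ε := by exact_mod_cast hT
  rw [div_lt_iff₀ (by positivity)] at hT
  exact hT.le

variable {B} {π : LearningPolicy M}

lemma UniformlyGood.eventually_expPlays_le (hπ : B.UniformlyGood π) {θ : Fin K → B.Θ} {c : Fin K}
    (hc : B.NoOptimalArm θ c) {a ε : ℝ} (ha : 0 < a) (hε : 0 < ε) :
    ∀ᶠ T : ℕ in atTop, B.expPlays θ π c T ≤ ε * (T : ℝ) ^ a := by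
  obtain ⟨δ, hδ, hδle⟩ := (Finset.univ.filter fun i => B.cluster i = c).exists_pos_forall_le
    (B.gap θ) (fun i hi => sub_pos.2 (hc i (by simpa using hi)))
  filter_upwards [hπ.eventually_expRegret_le θ ha (mul_pos hδ hε)] with T hT
  have h := B.sum_mul_expPlays_le_expRegret θ π {c} (fun _ => δ)
    (fun i hi => hδle i (by simpa using hi)) T
  rw [Finset.sum_singleton] at h
  have h2 : δ * B.expPlays θ π c T ≤ δ * (ε * (T : ℝ) ^ a) := by linarith
  exact le_of_mul_le_mul_left h2 hδ

/-- The plays of all clusters add up to `T`, so the left side counts plays outside `c`, each of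
which costs a fixed positive gap. -/
lemma UniformlyGood.eventually_sub_expPlays_le (hπ : B.UniformlyGood π) {θ : Fin K → B.Θ}
    {c : Fin K} (hc : ∀ i, B.cluster i ≠ c → B.mean θ i < B.optMean θ) {a ε : ℝ} (ha : 0 < a)
    (hε : 0 < ε) : ∀ᶠ T : ℕ in atTop, T - B.expPlays θ π c T ≤ ε * (T : ℝ) ^ a := by
  obtain ⟨δ, hδ, hδle⟩ := (Finset.univ.filter fun i => B.cluster i ≠ c).exists_pos_forall_le
    (B.gap θ) (fun i hi => sub_pos.2 (hc i (by simpa using hi)))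
  filter_upwards [hπ.eventually_expRegret_le θ ha (mul_pos hδ hε)] with T hT
  have h := B.sum_mul_expPlays_le_expRegret θ π (Finset.univ.erase c) (fun _ => δ)
    (fun i hi => hδle i (by simpa using hi)) T
  rw [← Finset.mul_sum, Finset.sum_erase_eq_sub (Finset.mem_univ c), sum_expPlays] at h
  have h2 : δ * (T - B.expPlays θ π c T) ≤ δ * (ε * (T : ℝ) ^ a) := by linarith
  exact le_of_mul_le_mul_left h2 hδ

/-- Logarithmic lower bound on the plays of a cluster `c` without optimal arm, from one confusing
parameter `ϑ` of that cluster, under which all optimal arms belong to `c`. -/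
lemma UniformlyGood.eventually_le_expPlays_div_log (hπ : B.UniformlyGood π) {θ : Fin K → B.Θ}
    {c : Fin K} (hc : B.NoOptimalArm θ c) {i : Fin M} (hi : B.cluster i = c) {ϑ : B.Θ}
    (hϑ : B.optMean θ < B.armMean i ϑ) {D : NNReal}
    (hD : ∀ j, B.cluster j = c → B.armKL j (θ c) ϑ ≤ D) {r : ℝ} (hr0 : 0 ≤ r) (hr : r * D < 1) :
    ∀ᶠ T : ℕ in atTop, r ≤ B.expPlays θ π c T / Real.log T := by
  set θ' := Function.update θ c ϑ with hθ'
  -- Strictness in `hϑ` matters: with a tie, an old optimal arm outside `c` would stay optimal and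
  -- the policy would not have to play `c`. This is why `phiStrict` appears.
  have hopt : ∀ j, B.cluster j ≠ c → B.mean θ' j < B.optMean θ' := by
    intro j hj
    have h1 : B.mean θ' j = B.mean θ j := by simp [mean, hθ', hj]
    have h2 : B.mean θ' i = B.armMean i ϑ := by simp [mean, hθ', hi]
    have h3 := B.mean_le_optMean θ' i
    have h4 := B.mean_le_optMean θ j
    linarith
  -- Chosen so that `r * D = 1 - 2 * a`, which leaves room for the losses in the exponent and in the
  -- probability of `s`.
  set a := (1 - r * D) / 2 with ha
  have hrD : 0 ≤ r * D := mul_nonneg hr0 D.2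
  have ha0 : 0 < a := by linarith
  have hlog : Tendsto (fun T : ℕ => Real.log T) atTop atTop :=
    Real.tendsto_log_atTop.comp tendsto_natCast_atTop_atTop
  -- Markov's inequality at level `T / 2` doubles these constants: `a / 4` gives `P sᶜ ≤ a / 2`, and
  -- `1 / 2` gives `T * Q s ≤ T ^ a`.
  filter_upwards [hπ.eventually_expPlays_le hc one_pos (ε := a / 4) (by positivity),
    hπ.eventually_sub_expPlays_le hopt ha0 (ε := 1 / 2) (by positivity),
    hlog.eventually_gt_atTop (2 / a), eventually_gt_atTop 1] with T hT1 hT2 hT3 hT4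
  have hT : (0 : ℝ) < T := by exact_mod_cast (zero_lt_one.trans hT4)
  have hlogT : 0 < Real.log T := lt_trans (by positivity) hT3
  rw [le_div_iff₀ hlogT]
  by_contra! hlt
  set P := B.histLaw θ π T
  set Q := B.histLaw θ' π T
  set N := B.expPlays θ π c T
  set s : Set (Fin T → Fin M × ℝ) := {h | (B.clusterPlays h c : ℝ) < T / 2} with hs
  have hsm : MeasurableSet s := measurableSet_lt
    (measurable_from_top.comp (B.measurable_clusterPlays c)) measurable_const
  have hP : 1 - a / 2 ≤ P.real s := by
    have h1 := mul_meas_ge_le_integral_of_nonneg (μ := P)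
      (f := fun h => (B.clusterPlays h c : ℝ)) (Eventually.of_forall fun h => Nat.cast_nonneg _)
      (B.integrable_clusterPlays θ π T c) (T / 2)
    rw [← B.expPlays_eq_integral_clusterPlays] at h1
    have h2 : {h : Fin T → Fin M × ℝ | (T : ℝ) / 2 ≤ (B.clusterPlays h c : ℝ)} = sᶜ := by
      ext h; simp [hs]
    rw [h2, probReal_compl_eq_one_sub hsm] at h1
    rw [Real.rpow_one] at hT1
    have h3 : T * (1 - P.real s) ≤ T * (a / 2) := by linarith
    linarith [le_of_mul_le_mul_left h3 hT]
  have hQ : T * Q.real s ≤ (T : ℝ) ^ a := by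
    have h1 := mul_meas_ge_le_integral_of_nonneg (μ := Q)
      (f := fun h => T - (B.clusterPlays h c : ℝ))
      (Eventually.of_forall fun h => sub_nonneg.2 (by exact_mod_cast B.clusterPlays_le h c))
      ((integrable_const _).sub (B.integrable_clusterPlays θ' π T c)) (T / 2)
    rw [integral_sub (integrable_const _) (B.integrable_clusterPlays θ' π T c),
      ← B.expPlays_eq_integral_clusterPlays] at h1
    simp only [integral_const, probReal_univ, one_smul] at h1
    have h2 : Q.real s ≤ Q.real {h | (T : ℝ) / 2 ≤ T - (B.clusterPlays h c : ℝ)} := by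
      refine measureReal_mono fun h hh => ?_
      simp only [hs, Set.mem_ofPred_eq] at hh ⊢
      linarith
    have h3 := mul_le_mul_of_nonneg_left h2 (half_pos hT).le
    linarith
  have hle := B.klDiv_histLaw_update_le θ π c ϑ ENNReal.coe_ne_top hD T
  rw [lintegral_clusterPlays, ← hθ'] at hle
  have hne : (D : ℝ≥0∞) * ENNReal.ofReal N ≠ ∞ :=
    ENNReal.mul_ne_top ENNReal.coe_ne_top ENNReal.ofReal_ne_top
  -- This `t` has `exp t = T ^ (1 - a)`, the largest size for which `exp t * Q s` is still known to
  -- be at most 1.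
  have hkl := mul_measureReal_add_le_toReal_klDiv (ne_top_of_le_ne_top hne hle) s
    ((1 - a) * Real.log T)
  have hle' := ENNReal.toReal_mono hne hle
  rw [ENNReal.toReal_mul, ENNReal.coe_toReal,
    ENNReal.toReal_ofReal (B.expPlays_nonneg θ π c T)] at hle'
  have hexp : Real.exp ((1 - a) * Real.log T) * Q.real s ≤ 1 := by
    have h1 : Real.exp ((1 - a) * Real.log T) = T / (T : ℝ) ^ a := by
      rw [mul_comm, ← Real.rpow_def_of_pos hT, Real.rpow_sub hT, Real.rpow_one]
    rw [h1, div_mul_eq_mul_div]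
    exact div_le_one_of_le₀ hQ (by positivity)
  have hmain : (1 - a) * Real.log T * (1 - a / 2) - 1 ≤ D * (r * Real.log T) := by
    have h1 : (1 - a) * Real.log T * (1 - a / 2) ≤ (1 - a) * Real.log T * P.real s :=
      mul_le_mul_of_nonneg_left hP (mul_nonneg (by linarith) hlogT.le)
    have h2 : (D : ℝ) * N ≤ D * (r * Real.log T) := mul_le_mul_of_nonneg_left hlt.le D.2
    have h3 : 0 ≤ Q.real s := measureReal_nonneg
    linarith
  have h2 : 2 < a * Real.log T := by rwa [div_lt_iff₀' ha0] at hT3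
  have h3 : (D : ℝ) * (r * Real.log T) = (1 - 2 * a) * Real.log T := by rw [ha]; ring
  rw [h3] at hmain
  -- Now `hmain` reads `(a / 2 + a ^ 2 / 2) * log T ≤ 1`, against `2 < a * log T`.
  nlinarith [mul_pos (mul_pos ha0 ha0) hlogT]

/-! ### From eventual bounds to the liminf, and from `phiStrict` to `phi`. -/

/-- Approximation from below by finite `r` treats `x = ∞` on the same footing as finite `x`. -/
lemma coe_le_liminf_of_forall_lt {x : ℝ≥0∞} {v : ℕ → ℝ} (hv : ∀ T, 0 ≤ v T)
    (h : ∀ r : NNReal, (r : ℝ≥0∞) < x → ∀ᶠ T in atTop, (r : ℝ) ≤ v T) :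
    (x : EReal) ≤ liminf (fun T => (v T : EReal)) atTop := by
  have h0 : 0 ≤ liminf (fun T => (v T : EReal)) atTop :=
    le_liminf_of_le (by isBoundedDefault)
      (Eventually.of_forall fun T => EReal.coe_nonneg.2 (hv T))
  rw [← EReal.coe_toENNReal h0, EReal.coe_ennreal_le_coe_ennreal_iff]
  refine ENNReal.le_of_forall_nnreal_lt fun r hr => ?_
  rw [← EReal.coe_ennreal_le_coe_ennreal_iff, EReal.coe_toENNReal h0]
  exact le_liminf_of_le (by isBoundedDefault)
    ((h r hr).mono fun T hT => EReal.coe_le_coe_iff.2 hT)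

lemma UniformlyGood.maxInv_phiStrict_le_liminf (hπ : B.UniformlyGood π) {θ : Fin K → B.Θ}
    {c : Fin K} (hc : B.NoOptimalArm θ c) :
    ((B.maxInv B.phiStrict θ c : ℝ≥0∞) : EReal) ≤
      liminf (fun T : ℕ => ((B.expPlays θ π c T / Real.log T : ℝ) : EReal)) atTop := by
  refine coe_le_liminf_of_forall_lt (fun T =>
    div_nonneg (B.expPlays_nonneg θ π c T) (Real.log_natCast_nonneg T)) fun r hr => ?_
  -- Inversion turns the infimum into a supremum, so `r` lies below the value at a single pair `i`,
  -- `ϑ`; the infimum need not be attained.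
  simp only [maxInv, phiStrict, ENNReal.inv_iInf, lt_iSup_iff] at hr
  obtain ⟨i, hi, ϑ, hϑ, hr⟩ := hr
  set D := ⨆ (j : Fin M) (_ : B.cluster j = B.cluster i), B.armKL j (θ c) ϑ with hDdef
  have hD : D ≠ ∞ := by
    rintro hD
    simp [hD] at hr
  refine hπ.eventually_le_expPlays_div_log hc hi hϑ (D := D.toNNReal) (fun j hj => ?_) r.2 ?_
  · rw [ENNReal.coe_toNNReal hD]
    exact le_iSup₂_of_le j (hj.trans hi.symm) le_rfl
  · rw [← ENNReal.coe_toNNReal hD] at hr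
    have hr' : (r : ℝ≥0∞) < 1 / (D.toNNReal : ℝ≥0∞) := by
      simpa [ENNReal.div_eq_inv_mul] using hr
    exact_mod_cast ENNReal.mul_lt_of_lt_div hr'

/-- Squeeze: `phi` at `m` is at most `phiStrict` at `m`, which is at most `phi` at every `m' > m`;
let `m'` decrease to `m`. -/
lemma phi_eq_phiStrict_of_continuousWithinAt (i : Fin M) (ϑ : B.Θ) (m : ℝ)
    (h : ContinuousWithinAt (fun m => B.phi i ϑ m) (Set.Ici m) m) :
    B.phi i ϑ m = B.phiStrict i ϑ m := by
  apply le_antisymm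
  · exact le_iInf₂ fun ϑ' hϑ' => iInf₂_le_of_le ϑ' hϑ'.le le_rfl
  · refine ge_of_tendsto (h.tendsto.mono_left (nhdsWithin_mono m Set.Ioi_subset_Ici_self)) ?_
    filter_upwards [self_mem_nhdsWithin] with m' hm'
    exact le_iInf₂ fun ϑ' hϑ' => iInf₂_le_of_le ϑ' (lt_of_lt_of_le hm' hϑ') le_rfl

lemma maxInv_phi_eq_maxInv_phiStrict {θ : Fin K → B.Θ} {c : Fin K} (h : B.PhiRightCont θ c) :
    B.maxInv B.phi θ c = B.maxInv B.phiStrict θ c :=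
  iSup_congr fun i => iSup_congr fun hi => by
    rw [phi_eq_phiStrict_of_continuousWithinAt i _ _ (h i hi)]

/-! ### Smallest gaps and the regret bound. -/

/-- The smallest gap `min_{i ∈ C} Δ_i` of the arms of a cluster. -/
noncomputable def minGap (B : ClusteredBandit M K d) (θ : Fin K → B.Θ) (c : Fin K) : ℝ≥0∞ :=
  ⨅ (i : Fin M) (_ : B.cluster i = c), ENNReal.ofReal (B.gap θ i)

lemma minGap_le (θ : Fin K → B.Θ) (i : Fin M) :
    B.minGap θ (B.cluster i) ≤ ENNReal.ofReal (B.gap θ i) :=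
  iInf₂_le_of_le i rfl le_rfl

/-- Rests on clusters being nonempty: an empty infimum would be `∞`. -/
lemma minGap_ne_top (θ : Fin K → B.Θ) (c : Fin K) : B.minGap θ c ≠ ∞ := by
  obtain ⟨i, rfl⟩ := B.cluster_surjective c
  exact ne_top_of_le_ne_top ENNReal.ofReal_ne_top (minGap_le θ i)

lemma minGap_eq_zero {θ : Fin K → B.Θ} {c : Fin K} (h : ¬ B.NoOptimalArm θ c) :
    B.minGap θ c = 0 := by
  simp only [NoOptimalArm, not_forall, not_lt] at h
  obtain ⟨i, rfl, hi⟩ := h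
  refine le_antisymm ((minGap_le θ i).trans ?_) bot_le
  simpa [gap] using hi

lemma minGap_pos {θ : Fin K → B.Θ} {c : Fin K} (h : B.NoOptimalArm θ c) : 0 < B.minGap θ c := by
  obtain ⟨δ, hδ, hle⟩ := (Finset.univ.filter fun i => B.cluster i = c).exists_pos_forall_le
    (B.gap θ) (fun i hi => sub_pos.2 (h i (by simpa using hi)))
  exact (ENNReal.ofReal_pos.2 hδ).trans_le
    (le_iInf₂ fun i hi => ENNReal.ofReal_le_ofReal (hle i (by simpa using hi)))

lemma regretTerm_eq (φ : Fin M → B.Θ → ℝ → ℝ≥0∞) (θ : Fin K → B.Θ) (c : Fin K) :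
    B.regretTerm φ θ c = B.minGap θ c * B.maxInv φ θ c := rfl

/-- A cluster with an optimal arm has smallest gap `0`, so both terms vanish by `0 * ∞ = 0` and
continuity is needed only elsewhere. -/
lemma regretTerm_phi_eq_regretTerm_phiStrict {θ : Fin K → B.Θ} {c : Fin K}
    (h : B.NoOptimalArm θ c → B.PhiRightCont θ c) :
    B.regretTerm B.phi θ c = B.regretTerm B.phiStrict θ c := by
  by_cases hc : B.NoOptimalArm θ c
  · rw [regretTerm_eq, regretTerm_eq, maxInv_phi_eq_maxInv_phiStrict (h hc)]
  · rw [regretTerm_eq, regretTerm_eq, minGap_eq_zero hc, zero_mul, zero_mul]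

lemma UniformlyGood.regretTerm_phiStrict_le_liminf (hπ : B.UniformlyGood π) (θ : Fin K → B.Θ)
    (c : Fin K) : ((B.regretTerm B.phiStrict θ c : ℝ≥0∞) : EReal) ≤
      liminf (fun T : ℕ => (((B.minGap θ c).toReal * (B.expPlays θ π c T / Real.log T) : ℝ) :
        EReal)) atTop := by
  by_cases hc : B.NoOptimalArm θ c
  · have h := hπ.maxInv_phiStrict_le_liminf hc
    rw [regretTerm_eq, EReal.coe_ennreal_mul]
    simp_rw [EReal.coe_mul]
    rw [EReal.liminf_const_mul_of_nonneg_of_ne_top (by simp) (by simp)]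
    have hm : (((B.minGap θ c).toReal : ℝ) : EReal) = (B.minGap θ c : EReal) := by
      rw [← EReal.toReal_coe_ennreal, EReal.coe_toReal (by simpa using minGap_ne_top θ c) (by simp)]
    rw [hm]
    exact mul_le_mul_of_nonneg_left h (EReal.coe_ennreal_nonneg _)
  · simp [regretTerm_eq, minGap_eq_zero hc]

lemma sum_liminf_le_liminf_sum {ι : Type*} (s : Finset ι) (v : ι → ℕ → ℝ) :
    ∑ i ∈ s, liminf (fun T => (v i T : EReal)) atTop
      ≤ liminf (fun T => ((∑ i ∈ s, v i T : ℝ) : EReal)) atTop := by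
  classical
  induction s using Finset.induction_on with
  | empty => simp
  | insert i s hi ih =>
    simp_rw [Finset.sum_insert hi, EReal.coe_add]
    exact (add_le_add le_rfl ih).trans EReal.le_liminf_add

lemma UniformlyGood.sum_regretTerm_phiStrict_le_liminf (hπ : B.UniformlyGood π)
    (θ : Fin K → B.Θ) (s : Finset (Fin K)) :
    ((∑ c ∈ s, B.regretTerm B.phiStrict θ c : ℝ≥0∞) : EReal) ≤
      liminf (fun T : ℕ => ((B.expRegret θ π T / Real.log T : ℝ) : EReal)) atTop := by
  calc ((∑ c ∈ s, B.regretTerm B.phiStrict θ c : ℝ≥0∞) : EReal)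
      = ∑ c ∈ s, ((B.regretTerm B.phiStrict θ c : ℝ≥0∞) : EReal) := by
        induction s using Finset.induction_on with
        | empty => simp
        | insert c s hc ih => rw [Finset.sum_insert hc, Finset.sum_insert hc,
            EReal.coe_ennreal_add, ih]
    _ ≤ _ := Finset.sum_le_sum fun c _ => hπ.regretTerm_phiStrict_le_liminf θ c
    _ ≤ _ := sum_liminf_le_liminf_sum s _
    _ ≤ _ := by
        refine liminf_le_liminf (Eventually.of_forall fun T => ?_)
        rw [EReal.coe_le_coe_iff]
        simp_rw [← mul_div_assoc]
        rw [← Finset.sum_div]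
        refine div_le_div_of_nonneg_right (B.sum_mul_expPlays_le_expRegret θ π s _ ?_ T)
          (Real.log_natCast_nonneg T)
        intro i _
        exact ENNReal.toReal_le_of_le_ofReal (B.gap_nonneg θ i) (minGap_le θ i)

/-! ### Positivity and finiteness of the extreme terms. -/

lemma iInf_regretTerm_pos {φ : Fin M → B.Θ → ℝ → ℝ≥0∞} {θ : Fin K → B.Θ} {s : Finset (Fin K)}
    (h : ∀ c ∈ s, B.NoOptimalArm θ c ∧ ∃ i, B.cluster i = c ∧ φ i (θ c) (B.optMean θ) ≠ ∞) :
    0 < ⨅ c ∈ s, B.regretTerm φ θ c := by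
  rw [← Finset.inf_eq_iInf, Finset.lt_inf_iff (by simp)]
  intro c hc
  obtain ⟨hopt, i, hi, hne⟩ := h c hc
  refine ENNReal.mul_pos (minGap_pos hopt).ne' (ne_of_gt ?_)
  exact (ENNReal.inv_pos.2 hne).trans_le
    (le_iSup₂ (f := fun i (_ : B.cluster i = c) => (φ i (θ c) (B.optMean θ))⁻¹) i hi)

lemma iSup_regretTerm_lt_top {φ : Fin M → B.Θ → ℝ → ℝ≥0∞} {θ : Fin K → B.Θ}
    {s : Finset (Fin K)}
    (h : ∀ i, B.cluster i ∈ s → φ i (θ (B.cluster i)) (B.optMean θ) ≠ 0) :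
    (⨆ c ∈ s, B.regretTerm φ θ c) < ∞ := by
  rw [← Finset.sup_eq_iSup, Finset.sup_lt_iff (by simp)]
  intro c hc
  refine ENNReal.mul_lt_top (minGap_ne_top θ c).lt_top ?_
  have : B.maxInv φ θ c = (Finset.univ.filter fun i => B.cluster i = c).sup
      fun i => (φ i (θ c) (B.optMean θ))⁻¹ := by
    rw [Finset.sup_eq_iSup, maxInv]
    simp
  rw [this, Finset.sup_lt_iff (by simp)]
  intro i hi
  obtain rfl := (Finset.mem_filter.1 hi).2
  exact ENNReal.inv_lt_top.2 (pos_iff_ne_zero.2 (h i hc))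

end ClusteredBandit

theorem theorem1 {M K d : ℕ} (B : ClusteredBandit M K d) (π : LearningPolicy M)
    (hπ : B.UniformlyGood π) (θ : Fin K → B.Θ) :
    -- plays of a cluster without optimal arm
    (∀ c : Fin K, B.NoOptimalArm θ c →
      ((B.maxInv B.phiStrict θ c : ℝ≥0∞) : EReal) ≤
          liminf (fun T : ℕ => ((B.expPlays θ π c T / Real.log T : ℝ) : EReal)) atTop ∧
        (B.PhiRightCont θ c →
          ((B.maxInv B.phi θ c : ℝ≥0∞) : EReal) ≤
            liminf (fun T : ℕ => ((B.expPlays θ π c T / Real.log T : ℝ) : EReal)) atTop)) ∧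
    -- regret
    (∀ iStar : Fin M, B.mean θ iStar = B.optMean θ →
      ((∑ c ∈ Finset.univ.erase (B.cluster iStar), B.regretTerm B.phiStrict θ c : ℝ≥0∞) : EReal) ≤
          liminf (fun T : ℕ => ((B.expRegret θ π T / Real.log T : ℝ) : EReal)) atTop ∧
        ((∀ c, B.NoOptimalArm θ c → B.PhiRightCont θ c) →
          ((∑ c ∈ Finset.univ.erase (B.cluster iStar), B.regretTerm B.phi θ c : ℝ≥0∞) : EReal) ≤
            liminf (fun T : ℕ => ((B.expRegret θ π T / Real.log T : ℝ) : EReal)) atTop)) ∧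
    -- the lower bound is of order `K - 1`
    (∀ iStar : Fin M, B.mean θ iStar = B.optMean θ → ∀ φ ∈ ({B.phi, B.phiStrict} : Set _),
      ((K - 1 : ℕ) : ℝ≥0∞) * (⨅ c ∈ Finset.univ.erase (B.cluster iStar), B.regretTerm φ θ c) ≤
          ∑ c ∈ Finset.univ.erase (B.cluster iStar), B.regretTerm φ θ c ∧
        ∑ c ∈ Finset.univ.erase (B.cluster iStar), B.regretTerm φ θ c ≤
          ((K - 1 : ℕ) : ℝ≥0∞) * (⨆ c ∈ Finset.univ.erase (B.cluster iStar), B.regretTerm φ θ c) ∧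
        ((∀ c, c ≠ B.cluster iStar → B.NoOptimalArm θ c ∧
            ∃ i, B.cluster i = c ∧ φ i (θ c) (B.optMean θ) ≠ ∞) →
          0 < ⨅ c ∈ Finset.univ.erase (B.cluster iStar), B.regretTerm φ θ c) ∧
        ((∀ i, B.cluster i ≠ B.cluster iStar → φ i (θ (B.cluster i)) (B.optMean θ) ≠ 0) →
          (⨆ c ∈ Finset.univ.erase (B.cluster iStar), B.regretTerm φ θ c) < ∞)) := by
  refine ⟨fun c hc => ⟨hπ.maxInv_phiStrict_le_liminf hc, fun hcont => ?_⟩, fun iStar _ =>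
    ⟨hπ.sum_regretTerm_phiStrict_le_liminf θ _, fun hcont => ?_⟩, fun iStar _ φ _ =>
    ⟨?_, ?_, fun h => ?_, fun h => ?_⟩⟩
  · rw [ClusteredBandit.maxInv_phi_eq_maxInv_phiStrict hcont]
    exact hπ.maxInv_phiStrict_le_liminf hc
  · rw [Finset.sum_congr rfl fun c _ =>
      ClusteredBandit.regretTerm_phi_eq_regretTerm_phiStrict (hcont c)]
    exact hπ.sum_regretTerm_phiStrict_le_liminf θ _
  · have := (Finset.univ.erase (B.cluster iStar)).card_nsmul_le_sum (B.regretTerm φ θ) _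
      fun c hc => iInf₂_le c hc
    simpa using this
  · have := (Finset.univ.erase (B.cluster iStar)).sum_le_card_nsmul (B.regretTerm φ θ) _
      fun c hc => le_iSup₂ (f := fun c (_ : c ∈ Finset.univ.erase (B.cluster iStar)) =>
        B.regretTerm φ θ c) c hc
    simpa using this
  · exact ClusteredBandit.iInf_regretTerm_pos fun c hc => h c (Finset.ne_of_mem_erase hc)
  · exact ClusteredBandit.iSup_regretTerm_lt_top fun i hi => h i (Finset.ne_of_mem_erase hi)
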